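/- **Optimality of a stationary Markovian policy for Wasserstein distributionally robust MDPs of type $\infty$.** Let $\mathbb S,\mathbb A$ be finite sets of states and actions with $\mathbb A\neq\emptyset$, let $c\in\mathbb R^{\mathbb S\times\mathbb A}$ be a cost and $\lambda\in[0,1)$ a discount factor. Write $\Delta(X)$ for the simplex of probability vectors on a finite set $X$, and let $\mathcal U=\Delta(\mathbb S)^{\mathbb A}$. Let $d$ be a metric on $\mathcal U$ inducing its usual topology (for example $\ell_1$, $\ell_2$ or $\ell_\infty$). For Borel probability measures $\mu,\nu$ on $\mathcal U$ let $$W_\infty(\mu,\nu)=\inf\{\kappa\text{-}\operatorname{ess\,sup} d \;:\; \kappa \text{ a coupling of } \mu \text{ and } \nu\}.$$ Let $N\ge 1$, $\theta\ge 0$, and for each state $s$ let $\hat y_{1,s},\dots,\hat y_{N,s}\in\mathcal U$ and $\nu_s=\frac1N\sum_{i=1}^N\delta_{\hat y_{i,s}}$. Consider the ambiguity sets $$\mathbb D_s=\{\mu_s\in P(\mathcal U): W_\infty(\mu_s,\nu_s)\le\theta\},\qquad \mathbb D=\Big\{\bigotimes_{s}\mu_s : \mu_s\in\mathbb D_s \text{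 for all } s\in\mathbb S\Big\}.$$ A policy $\pi$ is randomized and may depend on the history: at each time $t$ it gives a distribution over actions depending on $s_0,a_0,\dots,s_{t-1},a_{t-1},s_t$. The stationary Markovian policies are the $x\in\Pi=\Delta(\mathbb A)^{\mathbb S}$. Given an initial distribution $p_0\in\Delta(\mathbb S)$, a policy $\pi$ and $\mu\in\mathbb D$, let $s_0\sim p_0$, and at each time $t$ let $a_t$ be drawn from the policy and, independently of the past and of $a_t$, let a transition kernel $y_t=(y_{t,sa})_{s,a}\sim\mu$ be drawn; then $s_{t+1}\sim y_{t,s_ta_t}$. Put $$C_{p_0}(\pi,\mu)=\mathbb E\Big[\sum_{t=0}^\infty\lambda^t c_{s_ta_t}\Big],\qquad v_s=\inf_{x\in\Pi}\,\sup_{\mu\in\mathbb D}C_{\delta_s}(x,\mu),$$ and, for $s\in\mathbb S$ and $x\in\mathbb R^{\mathbb A}$, $$g_s(x)=\sup_{\mu_s\in\mathbb D_s}\ \mathbb E_{y\sim\mu_s}\Big[\sum_{a}x_a\big(c_{sa}+\lambda\, y_a^\top v\big)\Big].$$ Then: 1. for every $s$, the supremum defining $g_s(x)$ is attained for each $x\in\mathbb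 R^{\mathbb A}$, and $g_s:\mathbb R^{\mathbb A}\to\mathbb R$ is a closed (i.e. lower semicontinuous) proper convex function; 2. $v$ satisfies the Bellman equation $v_s=\min_{x\in\Delta(\mathbb A)}g_s(x)$ for every $s$, the minimum being attained; 3. there is $x^*\in\Pi$ such that, for every $s$, $x^*_s$ minimizes $g_s$ over $\Delta(\mathbb A)$; and every such stationary Markovian policy $x^*$ is optimal: for every $p_0\in\Delta(\mathbb S)$ the maximum $\max_{\mu\in\mathbb D}C_{p_0}(x^*,\mu)$ is attained, and $$\max_{\mu\in\mathbb D}C_{p_0}(x^*,\mu)\le\sup_{\mu\in\mathbb D}C_{p_0}(\pi,\mu)\quad\text{for every (history-dependent, randomized) policy }\pi.$$ -/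

import Mathlib

open MeasureTheory ProbabilityTheory
open scoped ENNReal

namespace DRMDP

/-- The set `𝒰 = Δ(S)^A` of the transition parameters of one state: each action is given a
probability vector on the set `S` of states. It carries the product (that is, Borel)
σ-algebra. -/
abbrev StateKernel (S A : Type*) [Fintype S] := A → stdSimplex ℝ S

/-- A full transition kernel `(y_{sa})_{s,a}`. -/
abbrev TransKernel (S A : Type*) [Fintype S] := S → StateKernel S A

/-! ### Type-∞ Wasserstein ambiguity sets -/

/-- `d` is a metric on `𝒰` that is continuous for the usual topology of `𝒰`. As `𝒰` is compact,
this says that `d` is a metric inducing the usual topology. Every metric that comes from a norm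
on `ℝ^{A × S}` is of this kind, for instance `ℓ₁`, `ℓ₂` and `ℓ_∞`. -/
structure IsKernelMetric {S A : Type*} [Fintype S]
    (d : StateKernel S A → StateKernel S A → ℝ) : Prop where
  eq_zero_iff : ∀ x y, d x y = 0 ↔ x = y
  symm : ∀ x y, d x y = d y x
  triangle : ∀ x y z, d x z ≤ d x y + d y z
  continuous : Continuous fun z : StateKernel S A × StateKernel S A => d z.1 z.2

/-- The type-∞ Wasserstein distance `W_∞(μ, ν)`: the least `κ`-essential supremum of `d` over all
couplings `κ` of `μ` and `ν`. -/
noncomputable def wassersteinInfty {S A : Type*} [Fintype S]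
    (d : StateKernel S A → StateKernel S A → ℝ) (μ ν : Measure (StateKernel S A)) : ℝ≥0∞ :=
  ⨅ κ ∈ {κ : ProbabilityMeasure (StateKernel S A × StateKernel S A) |
      (κ : Measure (StateKernel S A × StateKernel S A)).map Prod.fst = μ ∧
      (κ : Measure (StateKernel S A × StateKernel S A)).map Prod.snd = ν},
    essSup (fun z => ENNReal.ofReal (d z.1 z.2))
      (κ : Measure (StateKernel S A × StateKernel S A))

/-- The nominal distribution `(1/N) ∑ i, δ_{ŷ i}`. -/
noncomputable def empiricalMeasure {S A : Type*} [Fintype S] {N : ℕ}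
    (yhat : Fin N → StateKernel S A) : Measure (StateKernel S A) :=
  (N : ℝ≥0∞)⁻¹ • ∑ i, Measure.dirac (yhat i)

/-- The ambiguity set `𝔻_s` of one state: the ball of radius `θ` for `W_∞` around the nominal
distribution. -/
def stateAmbiguity {S A : Type*} [Fintype S] (d : StateKernel S A → StateKernel S A → ℝ) {N : ℕ}
    (yhat : Fin N → StateKernel S A) (θ : ℝ) : Set (ProbabilityMeasure (StateKernel S A)) :=
  {μ | wassersteinInfty d (μ : Measure (StateKernel S A)) (empiricalMeasure yhat)
    ≤ ENNReal.ofReal θ}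

/-- The `s`-rectangular ambiguity set `{⨂ μ_s | μ_s ∈ 𝔻_s for all s}` defined by the sets `𝔻_s`. -/
noncomputable def rectangular {S A : Type*} [Fintype S]
    (D : S → Set (ProbabilityMeasure (StateKernel S A))) :
    Set (ProbabilityMeasure (TransKernel S A)) :=
  {μ | ∃ m : S → ProbabilityMeasure (StateKernel S A),
    (∀ s, m s ∈ D s) ∧ μ = ProbabilityMeasure.pi m}

/-! ### Policies and the controlled process -/

/-- A randomized, history-dependent policy: at time `t`, given the past states and actions
`s_0, a_0, …, s_{t-1}, a_{t-1}` and the present state `s_t`, it returns a distribution over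
actions. -/
abbrev Policy (S A : Type*) [Fintype A] := (t : ℕ) → (Fin t → S × A) → S → stdSimplex ℝ A

/-- The stationary Markovian policy given by `x ∈ Π = Δ(A)^S`. -/
def stationary {S A : Type*} [Fintype A] (x : S → stdSimplex ℝ A) : Policy S A :=
  fun _ _ s => x s

/-- What happens at one time `t`: the state `s_t`, the action `a_t`, and the transition kernel
`y_t` that is realized at that time. -/
abbrev Stage (S A : Type*) [Fintype S] := S × A × TransKernel S A

/-- The law of a stage `(s, a, y)` with `s ∼ q`, `a ∼ f s`, and `y ∼ μ` independent of
`(s, a)`. -/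
noncomputable def stageLaw {S A : Type*} [Fintype S] [Fintype A] [MeasurableSpace S]
    [MeasurableSpace A] (q : stdSimplex ℝ S) (f : S → stdSimplex ℝ A)
    (μ : ProbabilityMeasure (TransKernel S A)) : Measure (Stage S A) :=
  ∑ s : S, ∑ a : A, ENNReal.ofReal (q s * f s a) •
    (Measure.dirac s).prod ((Measure.dirac a).prod (μ : Measure (TransKernel S A)))

theorem isProbabilityMeasure_stageLaw {S A : Type*} [Fintype S] [Fintype A] [MeasurableSpace S]
    [MeasurableSpace A] (q : stdSimplex ℝ S) (f : S → stdSimplex ℝ A)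
    (μ : ProbabilityMeasure (TransKernel S A)) : IsProbabilityMeasure (stageLaw q f μ) := by
  have hq : ∀ s, 0 ≤ q s := q.2.1
  have hf : ∀ s a, 0 ≤ f s a := fun s => (f s).2.1
  constructor
  simp only [stageLaw, Measure.coe_finsetSum, Finset.sum_apply, Measure.smul_apply, measure_univ,
    smul_eq_mul, mul_one]
  simp_rw [← ENNReal.ofReal_sum_of_nonneg (fun a _ => mul_nonneg (hq _) (hf _ a)),
    ← Finset.mul_sum]
  have h1 : ∀ s, ∑ a, f s a = 1 := fun s => (f s).2.2
  have h2 : ∑ s, q s = 1 := q.2.2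
  simp only [h1, mul_one]
  rw [← ENNReal.ofReal_sum_of_nonneg (fun s _ => hq s), h2, ENNReal.ofReal_one]

/-- The law of stage `n + 1` given the stages `0, …, n`: the new state is drawn from the row
`y_n(s_n, a_n)` of the kernel realized at time `n`, the action from the policy, and a new
kernel from `μ`. -/
noncomputable def stepKernel {S A : Type*} [Fintype S] [Fintype A] [MeasurableSpace S]
    [DiscreteMeasurableSpace S] [MeasurableSpace A] [DiscreteMeasurableSpace A]
    (π : Policy S A) (μ : ProbabilityMeasure (TransKernel S A)) (n : ℕ) :
    Kernel ((i : Finset.Iic n) → (fun _ : ℕ => Stage S A) i) ((fun _ : ℕ => Stage S A) (n + 1)) where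
  toFun h :=
    let last := h ⟨n, Finset.mem_Iic.2 le_rfl⟩
    let past : Fin (n + 1) → S × A := fun i =>
      let z := h ⟨i, Finset.mem_Iic.2 (Nat.lt_succ_iff.1 i.2)⟩
      (z.1, z.2.1)
    stageLaw (last.2.2 last.1 last.2.1) (π (n + 1) past) μ
  measurable' := by
    refine Measure.measurable_of_measurable_coe _ fun B hB => ?_
    simp only [stageLaw, Measure.coe_finsetSum, Finset.sum_apply, Measure.smul_apply, smul_eq_mul]
    refine Finset.measurable_sum _ fun s _ => Finset.measurable_sum _ fun a _ => ?_
    refine Measurable.mul_const (Measurable.ennreal_ofReal (Measurable.mul ?_ ?_)) _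
    · have h1 : Measurable fun z : S × A × TransKernel S A => z.2.2 z.1 z.2.1 s := by
        refine measurable_from_prod_countable_right fun s' => ?_
        refine measurable_from_prod_countable_right fun a' => ?_
        have h2 : Measurable fun y : TransKernel S A => y s' a' := by fun_prop
        exact (measurable_pi_apply s).comp (measurable_subtype_coe.comp h2)
      exact h1.comp (measurable_pi_apply _)
    · have h1 : Measurable fun p : Fin (n + 1) → S × A => π (n + 1) p s a :=
        measurable_of_finite _
      refine h1.comp (measurable_pi_lambda _ fun i => ?_)
      have h2 : Measurable fun z : S × A × TransKernel S A => (z.1, z.2.1) := by fun_prop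
      exact h2.comp (measurable_pi_apply _)

instance {S A : Type*} [Fintype S] [Fintype A] [MeasurableSpace S]
    [DiscreteMeasurableSpace S] [MeasurableSpace A] [DiscreteMeasurableSpace A]
    (π : Policy S A) (μ : ProbabilityMeasure (TransKernel S A)) (n : ℕ) :
    IsMarkovKernel (stepKernel π μ n) :=
  ⟨fun _ => isProbabilityMeasure_stageLaw _ _ _⟩

/-- The law of the whole process `(s_t, a_t, y_t)_{t ∈ ℕ}` with `s_0 ∼ p₀`, under the policy `π` and
the distribution `μ` of the transition kernels. -/
noncomputable def trajLaw {S A : Type*} [Fintype S] [Fintype A] [MeasurableSpace S]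
    [DiscreteMeasurableSpace S] [MeasurableSpace A] [DiscreteMeasurableSpace A]
    (p₀ : stdSimplex ℝ S) (π : Policy S A) (μ : ProbabilityMeasure (TransKernel S A)) :
    Measure (ℕ → Stage S A) :=
  ((stageLaw p₀ (π 0 Fin.elim0) μ).map
      fun z => (fun _ => z : (i : Finset.Iic 0) → (fun _ : ℕ => Stage S A) i)).bind
    (Kernel.traj (X := fun _ : ℕ => Stage S A) (stepKernel π μ) 0)

/-- The expected discounted cost `C(π, μ) = 𝔼 [∑ t, γ ^ t * c (s_t) (a_t) | s_0 ∼ p₀]`, with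
discount factor `γ`. -/
noncomputable def discountedCost {S A : Type*} [Fintype S] [Fintype A] [MeasurableSpace S]
    [DiscreteMeasurableSpace S] [MeasurableSpace A] [DiscreteMeasurableSpace A]
    (c : S → A → ℝ) (γ : ℝ) (p₀ : stdSimplex ℝ S) (π : Policy S A)
    (μ : ProbabilityMeasure (TransKernel S A)) : ℝ :=
  ∫ ω, ∑' t : ℕ, γ ^ t * c (ω t).1 (ω t).2.1 ∂(trajLaw p₀ π μ)

/-- The worst-case cost of a policy over the ambiguity set `D`. The costs are bounded, so for a
non-empty `D` this is a genuine supremum. -/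
noncomputable def worstCaseCost {S A : Type*} [Fintype S] [Fintype A] [MeasurableSpace S]
    [DiscreteMeasurableSpace S] [MeasurableSpace A] [DiscreteMeasurableSpace A]
    (c : S → A → ℝ) (γ : ℝ) (D : Set (ProbabilityMeasure (TransKernel S A)))
    (p₀ : stdSimplex ℝ S) (π : Policy S A) : ℝ :=
  sSup (discountedCost c γ p₀ π '' D)

/-- The value vector: `v s` is the optimal worst-case cost, over the stationary Markovian policies
`x ∈ Π`, from the initial state `s`. -/
noncomputable def valueVector {S A : Type*} [Fintype S] [DecidableEq S] [Fintype A]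
    [MeasurableSpace S] [DiscreteMeasurableSpace S] [MeasurableSpace A] [DiscreteMeasurableSpace A]
    (c : S → A → ℝ) (γ : ℝ) (D : Set (ProbabilityMeasure (TransKernel S A))) : S → ℝ :=
  fun s => ⨅ x : S → stdSimplex ℝ A,
    worstCaseCost c γ D (stdSimplex.vertex s) (stationary x)

/-! ### The Bellman equation -/

/-- `𝔼_{y ∼ μ} [∑ a, x_a (c_{sa} + γ y_aᵀ v)]` for one state, where `cs = (c_{sa})_a`. -/
noncomputable def bellmanCost {S A : Type*} [Fintype S] [Fintype A] (cs : A → ℝ) (γ : ℝ)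
    (v : S → ℝ) (x : A → ℝ) (μ : ProbabilityMeasure (StateKernel S A)) : ℝ :=
  ∫ y, ∑ a, x a * (cs a + γ * ∑ s', y a s' * v s') ∂(μ : Measure (StateKernel S A))

/-- The function of `x` that is minimized over the simplex in the Bellman equation: the worst case
of `bellmanCost` over the ambiguity set of the state. -/
noncomputable def bellmanObjective {S A : Type*} [Fintype S] [Fintype A] (cs : A → ℝ) (γ : ℝ)
    (D : Set (ProbabilityMeasure (StateKernel S A))) (v : S → ℝ) (x : A → ℝ) : ℝ :=
  sSup (bellmanCost cs γ v x '' D)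

end DRMDP

/-!
The Bellman operator `w ↦ (s ↦ min_x g_s(x))` is a `γ`-contraction, so it has a fixed point `w`. For
any policy and any law of the kernels, the discounted sum of the expected Bellman residuals
`c_{s a} + γ y_{s a}ᵀ w - w_s` telescopes to the cost minus `p₀ᵀ w`, so the sign of the conditional
expectations of the residuals decides how the cost compares with `p₀ᵀ w`. If `x_s` minimizes `g_s`
for every `s`, they are nonpositive against every law in `𝔻`, and the cost of `x` is at most
`p₀ᵀ w`. Conversely, as `𝔻_s` is compact and convex, a minimax argument gives one law `μ_s ∈ 𝔻_s`
under which every action at `s` costs at least `w_s`; against `⨂ μ_s` the residuals are nonnegative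
whatever the history-dependent policy is. Hence `w` is the value vector.

The ball `𝔻_s` is compact because it is the intersection, over the radii `r > θ`, of the first
marginals of the couplings supported in `{d ≤ r}`, and these couplings form a closed subset of the
compact space of laws on `𝒰 × 𝒰`.
-/

namespace DRMDP

open Filter Topology Set

section AmbiguitySet

theorem isClosed_setOf_ae_mem {X : Type*} [TopologicalSpace X] [MeasurableSpace X]
    [OpensMeasurableSpace X] [HasOuterApproxClosed X] {F : Set X} (hF : IsClosed F) :
    IsClosed {κ : ProbabilityMeasure X | ∀ᵐ z ∂(κ : Measure X), z ∈ F} := by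
  refine isClosed_of_closure_subset fun κ hκ => ?_
  obtain ⟨l, hl, hlκ⟩ := mem_closure_iff_ultrafilter.1 hκ
  have hlim := ProbabilityMeasure.le_liminf_measure_open_of_tendsto
    (tendsto_id'.2 hlκ) hF.isOpen_compl
  have hzero : (fun κ : ProbabilityMeasure X => (κ : Measure X) Fᶜ) =ᶠ[l] fun _ => 0 := hl
  simp only [id_eq, liminf_congr hzero, liminf_const] at hlim
  exact le_bot_iff.1 hlim

theorem isProbabilityMeasure_empiricalMeasure {S A : Type*} [Fintype S] {N : ℕ} (hN : 0 < N)
    (yhat : Fin N → StateKernel S A) : IsProbabilityMeasure (empiricalMeasure yhat) := by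
  constructor
  simp only [empiricalMeasure, Measure.smul_apply, Measure.coe_finsetSum, Finset.sum_apply,
    measure_univ, Finset.sum_const, Finset.card_univ, Fintype.card_fin, nsmul_eq_mul, mul_one,
    smul_eq_mul]
  exact ENNReal.inv_mul_cancel (by exact_mod_cast hN.ne') (ENNReal.natCast_ne_top N)

variable {S A : Type*} [Fintype S] {d : StateKernel S A → StateKernel S A → ℝ}
  {ν : Measure (StateKernel S A)} {r : ℝ≥0∞}

/-- The couplings with second marginal `ν` under which `d` is almost surely at most `r`. Their first
marginals are the laws obtained from `ν` by moving its mass by at most `r`. -/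
def boundedCouplings (d : StateKernel S A → StateKernel S A → ℝ) (ν : Measure (StateKernel S A))
    (r : ℝ≥0∞) : Set (ProbabilityMeasure (StateKernel S A × StateKernel S A)) :=
  {κ | (κ : Measure (StateKernel S A × StateKernel S A)).map Prod.snd = ν ∧
    ∀ᵐ z ∂(κ : Measure (StateKernel S A × StateKernel S A)), ENNReal.ofReal (d z.1 z.2) ≤ r}

theorem wassersteinInfty_le_iff {μ : Measure (StateKernel S A)} :
    wassersteinInfty d μ ν ≤ r ↔ ∀ r' > r, ∃ κ ∈ boundedCouplings d ν r',
      (κ : Measure (StateKernel S A × StateKernel S A)).map Prod.fst = μ := by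
  refine ⟨fun h r' hr' => ?_, fun h => le_of_forall_gt_imp_ge_of_dense fun r' hr' => ?_⟩
  · have hlt := h.trans_lt hr'
    simp only [wassersteinInfty, iInf_lt_iff] at hlt
    obtain ⟨κ, ⟨hfst, hsnd⟩, hκ⟩ := hlt
    exact ⟨κ, ⟨hsnd, (ae_lt_of_essSup_lt hκ).mono fun _ hz => hz.le⟩, hfst⟩
  · obtain ⟨κ, ⟨hsnd, hκ⟩, hfst⟩ := h r' hr'
    exact (iInf₂_le κ ⟨hfst, hsnd⟩).trans (essSup_le_of_ae_le _ hκ)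

theorem convex_image_boundedCouplings :
    Convex ℝ≥0∞ ((↑) '' boundedCouplings d ν r :
      Set (Measure (StateKernel S A × StateKernel S A))) := by
  rintro _ ⟨κ₁, ⟨hsnd₁, hκ₁⟩, rfl⟩ _ ⟨κ₂, ⟨hsnd₂, hκ₂⟩, rfl⟩ a b - - hab
  refine ⟨⟨a • κ₁ + b • κ₂, ⟨by simp [hab]⟩⟩, ⟨?_, ?_⟩, rfl⟩
  · simp only [ProbabilityMeasure.coe_mk, Measure.map_add _ _ measurable_snd, Measure.map_smul,
      hsnd₁, hsnd₂, ← add_smul, hab, one_smul]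
  · simp only [ProbabilityMeasure.coe_mk, ae_add_measure_iff]
    exact ⟨Measure.ae_smul_measure hκ₁ a, Measure.ae_smul_measure hκ₂ b⟩

theorem convex_image_setOf_wassersteinInfty_le :
    Convex ℝ≥0∞ ((↑) '' {μ : ProbabilityMeasure (StateKernel S A) |
      wassersteinInfty d μ ν ≤ r} : Set (Measure (StateKernel S A))) := by
  rintro _ ⟨μ₁, h₁, rfl⟩ _ ⟨μ₂, h₂, rfl⟩ a b ha hb hab
  refine ⟨⟨a • μ₁ + b • μ₂, ⟨by simp [hab]⟩⟩, wassersteinInfty_le_iff.2 fun r' hr' => ?_, rfl⟩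
  obtain ⟨κ₁, hκ₁, hfst₁⟩ := wassersteinInfty_le_iff.1 h₁ r' hr'
  obtain ⟨κ₂, hκ₂, hfst₂⟩ := wassersteinInfty_le_iff.1 h₂ r' hr'
  obtain ⟨κ, hκ, hκe⟩ := convex_image_boundedCouplings (mem_image_of_mem _ hκ₁)
    (mem_image_of_mem _ hκ₂) ha hb hab
  refine ⟨κ, hκ, ?_⟩
  rw [hκe, Measure.map_add _ _ measurable_fst, Measure.map_smul, Measure.map_smul, hfst₁, hfst₂,
    ProbabilityMeasure.coe_mk]

theorem isClosed_boundedCouplings [Countable A]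
    (hd : Continuous fun z : StateKernel S A × StateKernel S A => d z.1 z.2)
    (ν : ProbabilityMeasure (StateKernel S A)) : IsClosed (boundedCouplings d ν r) := by
  have hsnd : IsClosed {κ : ProbabilityMeasure (StateKernel S A × StateKernel S A) |
      κ.map continuous_snd.measurable.aemeasurable = ν} :=
    isClosed_singleton.preimage (ProbabilityMeasure.continuous_map continuous_snd)
  have hbound : IsClosed {z : StateKernel S A × StateKernel S A | ENNReal.ofReal (d z.1 z.2) ≤ r} :=
    isClosed_le (ENNReal.continuous_ofReal.comp hd) continuous_const
  convert hsnd.inter (isClosed_setOf_ae_mem hbound) using 1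
  ext κ
  simp only [boundedCouplings, mem_inter_iff, mem_ofPred_eq,
    ← ProbabilityMeasure.toMeasure_injective.eq_iff, ProbabilityMeasure.toMeasure_map]

theorem isCompact_setOf_wassersteinInfty_le [Countable A]
    (hd : Continuous fun z : StateKernel S A × StateKernel S A => d z.1 z.2)
    (ν : ProbabilityMeasure (StateKernel S A)) :
    IsCompact {μ : ProbabilityMeasure (StateKernel S A) | wassersteinInfty d μ ν ≤ r} := by
  have hball : {μ : ProbabilityMeasure (StateKernel S A) | wassersteinInfty d μ ν ≤ r} =
      ⋂ r' > r, (fun κ => κ.map continuous_fst.measurable.aemeasurable) ''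
        boundedCouplings d ν r' := by
    ext μ
    simp only [mem_ofPred_eq, wassersteinInfty_le_iff, mem_iInter, mem_image,
      ← ProbabilityMeasure.toMeasure_injective.eq_iff, ProbabilityMeasure.toMeasure_map]
  rw [hball]
  refine (isClosed_biInter fun r' _ => ?_).isCompact
  exact ((isClosed_boundedCouplings hd ν).isCompact.image
    (ProbabilityMeasure.continuous_map continuous_fst)).isClosed

theorem wassersteinInfty_self
    (hd : Measurable fun z : StateKernel S A × StateKernel S A => d z.1 z.2)
    (hd₀ : ∀ y, d y y = 0) (ν : ProbabilityMeasure (StateKernel S A)) :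
    wassersteinInfty d ν ν = 0 := by
  have hdiag : Measurable fun y : StateKernel S A => (y, y) := by fun_prop
  refine le_bot_iff.1 (wassersteinInfty_le_iff.2 fun r' _ =>
    ⟨ν.map hdiag.aemeasurable, ⟨?_, ?_⟩, ?_⟩)
  · rw [ProbabilityMeasure.toMeasure_map, Measure.map_map measurable_snd hdiag]
    exact Measure.map_id
  · rw [ProbabilityMeasure.toMeasure_map, ae_map_iff hdiag.aemeasurable
      (measurableSet_le hd.ennreal_ofReal measurable_const)]
    exact .of_forall fun y => by simp only [hd₀, ENNReal.ofReal_zero, zero_le]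
  · rw [ProbabilityMeasure.toMeasure_map, Measure.map_map measurable_fst hdiag]
    exact Measure.map_id

variable {N : ℕ} {θ : ℝ}

theorem convex_image_stateAmbiguity (yhat : Fin N → StateKernel S A) :
    Convex ℝ≥0∞ ((↑) '' stateAmbiguity d yhat θ : Set (Measure (StateKernel S A))) :=
  convex_image_setOf_wassersteinInfty_le

theorem isCompact_stateAmbiguity [Countable A]
    (hd : Continuous fun z : StateKernel S A × StateKernel S A => d z.1 z.2) (hN : 0 < N)
    (yhat : Fin N → StateKernel S A) : IsCompact (stateAmbiguity d yhat θ) :=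
  isCompact_setOf_wassersteinInfty_le hd ⟨_, isProbabilityMeasure_empiricalMeasure hN yhat⟩

theorem nonempty_stateAmbiguity
    (hd : Measurable fun z : StateKernel S A × StateKernel S A => d z.1 z.2)
    (hd₀ : ∀ y, d y y = 0) (hN : 0 < N) (yhat : Fin N → StateKernel S A) :
    (stateAmbiguity d yhat θ).Nonempty :=
  ⟨⟨_, isProbabilityMeasure_empiricalMeasure hN yhat⟩,
    (wassersteinInfty_self hd hd₀ _).trans_le zero_le⟩

end AmbiguitySet

section Minimax

variable {ι : Type*} [Fintype ι]

theorem sum_mul_le_sum_mul_add {p : ι → ℝ} (hp : p ∈ stdSimplex ℝ ι) {f g : ι → ℝ} {δ : ℝ}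
    (h : ∀ i, f i ≤ g i + δ) : ∑ i, p i * f i ≤ ∑ i, p i * g i + δ := by
  calc ∑ i, p i * f i ≤ ∑ i, p i * (g i + δ) :=
        Finset.sum_le_sum fun i _ => mul_le_mul_of_nonneg_left (h i) (hp.1 i)
    _ = ∑ i, p i * g i + δ := by
        simp only [mul_add, Finset.sum_add_distrib, ← Finset.sum_mul, hp.2, one_mul]

theorem nonneg_of_forall_lt_of_le {E : Type*} [AddCommGroup E] [PartialOrder E]
    [IsOrderedAddMonoid E] [Module ℝ E] [PosSMulMono ℝ E] {f : E →ₗ[ℝ] ℝ} {b : E} {t : ℝ}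
    (h : ∀ x, b ≤ x → t < f x) {e : E} (he : 0 ≤ e) : 0 ≤ f e := by
  by_contra! hneg
  have hb := h b le_rfl
  have hle : b ≤ b + ((f b - t) / -f e) • e :=
    le_add_of_nonneg_right (smul_nonneg (div_nonneg (by linarith) (by linarith)) he)
  have hlt := h _ hle
  rw [map_add, map_smul, smul_eq_mul, div_neg, neg_mul, div_mul_cancel₀ _ hneg.ne] at hlt
  linarith

/-- Separating `K` from the orthant `{k | ∀ i, r ≤ k i}` gives, after normalization, a point of the
simplex which contradicts the hypothesis. -/
theorem exists_mem_forall_le_of_forall_stdSimplex {K : Set (ι → ℝ)} (hK : IsCompact K)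
    (hKconv : Convex ℝ K) (hKne : K.Nonempty) {r : ℝ}
    (h : ∀ x ∈ stdSimplex ℝ ι, ∃ k ∈ K, r ≤ ∑ i, x i * k i) : ∃ k ∈ K, ∀ i, r ≤ k i := by
  classical
  by_contra! hcon
  have hdisj : Disjoint K (Ici fun _ => r) := disjoint_left.2 fun k hk hrk =>
    let ⟨i, hi⟩ := hcon k hk
    hi.not_ge (hrk i)
  obtain ⟨f, s, t, hfK, hst, hft⟩ :=
    geometric_hahn_banach_compact_closed hKconv hK (convex_Ici _) isClosed_Ici hdisj
  set p : ι → ℝ := fun i => f (Pi.single i 1)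
  have hf : ∀ k, f k = ∑ i, p i * k i := fun k => by
    conv_lhs => rw [pi_eq_sum_univ' k]
    simp only [map_sum, map_smul, smul_eq_mul, p, mul_comm]
  have hp : ∀ i, 0 ≤ p i := fun i =>
    nonneg_of_forall_lt_of_le (f := f.toLinearMap) hft (Pi.single_nonneg.2 zero_le_one)
  have hfr : t < (∑ i, p i) * r := by
    rw [Finset.sum_mul, ← hf]
    exact hft _ self_mem_Ici
  have hpos : 0 < ∑ i, p i := by
    refine (Finset.sum_nonneg fun i _ => hp i).lt_of_ne' fun hzero => ?_
    obtain ⟨k, hk⟩ := hKne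
    have hp0 := (Finset.sum_eq_zero_iff_of_nonneg fun i _ => hp i).1 hzero
    have hfk : f k = 0 := by
      rw [hf]
      exact Finset.sum_eq_zero fun i hi => by rw [hp0 i hi, zero_mul]
    have := hfK k hk
    rw [hzero, zero_mul] at hfr
    linarith
  obtain ⟨k, hk, hrk⟩ := h (fun i => p i / ∑ i, p i)
    ⟨fun i => div_nonneg (hp i) hpos.le, by rw [← Finset.sum_div, div_self hpos.ne']⟩
  simp only [div_mul_eq_mul_div, ← Finset.sum_div, ← hf, le_div_iff₀ hpos] at hrk
  linarith [hfK k hk]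

end Minimax

section Bellman

variable {S A : Type*} [Fintype S] {cs : A → ℝ} {γ : ℝ} {u v : S → ℝ}
  {D : Set (ProbabilityMeasure (StateKernel S A))}

/-- The expected cost `𝔼_{y ∼ m} [c_{sa} + γ y_aᵀ v]` of the action `a` followed by the
values `v`, where `cs = (c_{sa})_a`. -/
noncomputable def actionValue (cs : A → ℝ) (γ : ℝ) (v : S → ℝ)
    (m : ProbabilityMeasure (StateKernel S A)) (a : A) : ℝ :=
  ∫ y, (cs a + γ * ∑ s', y a s' * v s') ∂(m : Measure (StateKernel S A))

theorem continuous_cost_add_sum (k : ℝ) (γ : ℝ) (v : S → ℝ) (a : A) :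
    Continuous fun y : StateKernel S A => k + γ * ∑ s', y a s' * v s' := by
  have hcoord (s' : S) : Continuous fun y : StateKernel S A => y a s' :=
    (continuous_apply s').comp (continuous_subtype_val.comp (continuous_apply a))
  exact continuous_const.add (continuous_const.mul
    (continuous_finsetSum _ fun s' _ => (hcoord s').mul continuous_const))

theorem integrable_of_continuous {X : Type*} [TopologicalSpace X] [CompactSpace X]
    [MeasurableSpace X] [OpensMeasurableSpace X] {f : X → ℝ} (hf : Continuous f)
    (m : Measure X) [IsFiniteMeasure m] : Integrable f m :=
  hf.integrable_of_hasCompactSupport (.of_compactSpace f)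

theorem continuous_actionValue [Countable A] : Continuous (actionValue cs γ v) :=
  continuous_pi fun a => ProbabilityMeasure.continuous_integral_continuousMap
    (⟨_, continuous_cost_add_sum (cs a) γ v a⟩ : C(StateKernel S A, ℝ))

theorem actionValue_le_add_dist [Countable A] (hγ : 0 ≤ γ) (u v : S → ℝ)
    (m : ProbabilityMeasure (StateKernel S A)) (a : A) :
    actionValue cs γ u m a ≤ actionValue cs γ v m a + γ * dist u v := by
  have hpoint (y : StateKernel S A) : cs a + γ * ∑ s', y a s' * u s' ≤
      cs a + γ * ∑ s', y a s' * v s' + γ * dist u v := by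
    rw [add_assoc, ← mul_add]
    gcongr
    refine sum_mul_le_sum_mul_add (y a).2 fun s' => ?_
    linarith [le_abs_self (u s' - v s'), Real.dist_eq (u s') (v s'), dist_le_pi_dist u v s']
  have hint (w : S → ℝ) : Integrable (fun y : StateKernel S A => cs a + γ * ∑ s', y a s' * w s')
      (m : Measure (StateKernel S A)) :=
    integrable_of_continuous (continuous_cost_add_sum (cs a) γ w a) _
  calc actionValue cs γ u m a ≤ ∫ y, (cs a + γ * ∑ s', y a s' * v s' + γ * dist u v)
        ∂(m : Measure (StateKernel S A)) :=
        integral_mono (hint u) ((hint v).add (integrable_const _)) hpoint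
    _ = actionValue cs γ v m a + γ * dist u v := by
        rw [integral_add (hint v) (integrable_const _), integral_const, probReal_univ, one_smul,
          actionValue]

theorem convex_image_actionValue [Countable A]
    (hD : Convex ℝ≥0∞ ((↑) '' D : Set (Measure (StateKernel S A)))) :
    Convex ℝ (actionValue cs γ v '' D) := by
  rintro _ ⟨m₁, h₁, rfl⟩ _ ⟨m₂, h₂, rfl⟩ a b ha hb hab
  obtain ⟨m, hm, hmix⟩ := hD (mem_image_of_mem _ h₁) (mem_image_of_mem _ h₂)
    (zero_le (a := ENNReal.ofReal a)) (zero_le (a := ENNReal.ofReal b))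
    (by rw [← ENNReal.ofReal_add ha hb, hab, ENNReal.ofReal_one])
  refine ⟨m, hm, funext fun i => ?_⟩
  have hint (m : ProbabilityMeasure (StateKernel S A)) :=
    integrable_of_continuous (continuous_cost_add_sum (cs i) γ v i)
      (m : Measure (StateKernel S A))
  simp only [actionValue, Pi.add_apply, Pi.smul_apply, hmix]
  rw [integral_add_measure ((hint m₁).smul_measure ENNReal.ofReal_ne_top)
    ((hint m₂).smul_measure ENNReal.ofReal_ne_top), integral_smul_measure, integral_smul_measure,
    ENNReal.toReal_ofReal ha, ENNReal.toReal_ofReal hb]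

variable [Fintype A]

theorem bellmanCost_eq_sum (x : A → ℝ) (m : ProbabilityMeasure (StateKernel S A)) :
    bellmanCost cs γ v x m = ∑ a, x a * actionValue cs γ v m a := by
  simp only [bellmanCost, actionValue, ← integral_const_mul]
  exact integral_finsetSum _ fun a _ => (integrable_of_continuous
    (continuous_cost_add_sum (cs a) γ v a) _).const_mul _

theorem isGreatest_bellmanObjective (hD : IsCompact D) (hDne : D.Nonempty) (x : A → ℝ) :
    IsGreatest (bellmanCost cs γ v x '' D) (bellmanObjective cs γ D v x) := by
  have hcont : Continuous (bellmanCost cs γ v x) := by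
    have := continuous_actionValue (cs := cs) (γ := γ) (v := v)
    simp only [funext (bellmanCost_eq_sum (cs := cs) (γ := γ) (v := v) x)]
    fun_prop
  exact (hD.image hcont).isGreatest_sSup (hDne.image _)

theorem convexOn_bellmanObjective (hD : IsCompact D) (hDne : D.Nonempty) :
    ConvexOn ℝ univ (bellmanObjective cs γ D v) := by
  refine ⟨convex_univ, fun x _ y _ a b ha hb _ => ?_⟩
  obtain ⟨m, hm, hmax⟩ := (isGreatest_bellmanObjective hD hDne (a • x + b • y)).1
  calc bellmanObjective cs γ D v (a • x + b • y) = bellmanCost cs γ v (a • x + b • y) m := hmax.symm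
    _ = a • bellmanCost cs γ v x m + b • bellmanCost cs γ v y m := by
        simp only [bellmanCost_eq_sum, Pi.add_apply, Pi.smul_apply, smul_eq_mul, add_mul, mul_assoc,
          Finset.sum_add_distrib, Finset.mul_sum]
    _ ≤ a • bellmanObjective cs γ D v x + b • bellmanObjective cs γ D v y := by
        gcongr <;> exact (isGreatest_bellmanObjective hD hDne _).2 (mem_image_of_mem _ hm)

theorem continuous_bellmanObjective (hD : IsCompact D) (hDne : D.Nonempty) :
    Continuous (bellmanObjective cs γ D v) :=
  (convexOn_bellmanObjective hD hDne).locallyLipschitz.continuous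

theorem exists_isLeast_bellmanObjective [Nonempty A] (hD : IsCompact D) (hDne : D.Nonempty)
    (cs : A → ℝ) (γ : ℝ) (v : S → ℝ) :
    ∃ t, IsLeast (bellmanObjective cs γ D v '' stdSimplex ℝ A) t := by
  have hne : (stdSimplex ℝ A).Nonempty := nonempty_coe_sort.1 inferInstance
  exact ((isCompact_stdSimplex ℝ A).image
    (continuous_bellmanObjective hD hDne)).exists_isLeast (hne.image _)

theorem bellmanObjective_le_add_dist (hD : IsCompact D) (hDne : D.Nonempty) (hγ : 0 ≤ γ)
    (u v : S → ℝ) {x : A → ℝ} (hx : x ∈ stdSimplex ℝ A) :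
    bellmanObjective cs γ D u x ≤ bellmanObjective cs γ D v x + γ * dist u v := by
  obtain ⟨m, hm, hmax⟩ := (isGreatest_bellmanObjective (cs := cs) (γ := γ) (v := u) hD hDne x).1
  calc bellmanObjective cs γ D u x = bellmanCost cs γ u x m := hmax.symm
    _ ≤ bellmanCost cs γ v x m + γ * dist u v := by
        simp only [bellmanCost_eq_sum]
        exact sum_mul_le_sum_mul_add hx (actionValue_le_add_dist hγ u v m)
    _ ≤ bellmanObjective cs γ D v x + γ * dist u v := by
        gcongr
        exact (isGreatest_bellmanObjective hD hDne x).2 (mem_image_of_mem _ hm)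

theorem isLeast_bellmanObjective_le_add_dist (hD : IsCompact D) (hDne : D.Nonempty) (hγ : 0 ≤ γ)
    {r t : ℝ} (hr : IsLeast (bellmanObjective cs γ D u '' stdSimplex ℝ A) r)
    (ht : IsLeast (bellmanObjective cs γ D v '' stdSimplex ℝ A) t) : r ≤ t + γ * dist u v := by
  obtain ⟨x, hx, rfl⟩ := ht.1
  exact (hr.2 (mem_image_of_mem _ hx)).trans (bellmanObjective_le_add_dist hD hDne hγ u v hx)

theorem exists_bellman_fixedPoint [Nonempty A] (hγ0 : 0 ≤ γ) (hγ1 : γ < 1) (c : S → A → ℝ)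
    {Ds : S → Set (ProbabilityMeasure (StateKernel S A))} (hD : ∀ s, IsCompact (Ds s))
    (hDne : ∀ s, (Ds s).Nonempty) :
    ∃ w : S → ℝ, ∀ s, IsLeast (bellmanObjective (c s) γ (Ds s) w '' stdSimplex ℝ A) (w s) := by
  choose T hT using fun (w : S → ℝ) (s : S) =>
    exists_isLeast_bellmanObjective (hD s) (hDne s) (c s) γ w
  have hle (u v : S → ℝ) (s : S) : T u s ≤ T v s + γ * dist u v :=
    isLeast_bellmanObjective_le_add_dist (hD s) (hDne s) hγ0 (hT u s) (hT v s)
  have hcontr : ContractingWith ⟨γ, hγ0⟩ T := by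
    refine ⟨hγ1, LipschitzWith.of_dist_le_mul fun u v =>
      (dist_pi_le_iff (mul_nonneg hγ0 dist_nonneg)).2 fun s => ?_⟩
    rw [Real.dist_eq, abs_sub_le_iff]
    have huv := hle u v s
    have hvu := hle v u s
    rw [dist_comm v u] at hvu
    constructor <;> linarith
  refine ⟨hcontr.fixedPoint, fun s => ?_⟩
  simpa only [hcontr.fixedPoint_isFixedPt.eq] using hT hcontr.fixedPoint s

theorem exists_mem_forall_le_actionValue (hD : IsCompact D) (hDne : D.Nonempty)
    (hDconv : Convex ℝ≥0∞ ((↑) '' D : Set (Measure (StateKernel S A)))) {r : ℝ}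
    (hr : ∀ x ∈ stdSimplex ℝ A, r ≤ bellmanObjective cs γ D v x) :
    ∃ m ∈ D, ∀ a, r ≤ actionValue cs γ v m a := by
  suffices h : ∃ k ∈ actionValue cs γ v '' D, ∀ a, r ≤ k a from exists_mem_image.1 h
  refine exists_mem_forall_le_of_forall_stdSimplex (hD.image continuous_actionValue)
    (convex_image_actionValue hDconv) (hDne.image _) fun x hx => ?_
  obtain ⟨m, hm, hmax⟩ := (isGreatest_bellmanObjective (cs := cs) (γ := γ) (v := v) hD hDne x).1
  exact ⟨_, mem_image_of_mem _ hm, by rw [← bellmanCost_eq_sum, hmax]; exact hr x hx⟩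

end Bellman

section Stage

variable {S A : Type*} [Fintype S]

theorem measurable_const_history [MeasurableSpace S] [MeasurableSpace A] : Measurable
    fun z : Stage S A => (fun _ => z : (i : Finset.Iic 0) → (fun _ : ℕ => Stage S A) i) :=
  measurable_pi_lambda _ fun _ => measurable_id

theorem exists_forall_abs_le_of_continuous [Finite A] {f : Stage S A → ℝ}
    (hf : ∀ s a, Continuous fun y => f (s, a, y)) : ∃ M, ∀ z, |f z| ≤ M := by
  choose M hM using fun s a => bddAbove_def.1 (isCompact_range (hf s a).abs).bddAbove
  obtain ⟨B, hB⟩ := (finite_range fun p : S × A => M p.1 p.2).bddAbove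
  exact ⟨B, fun ⟨s, a, y⟩ => (hM s a _ (mem_range_self y)).trans (hB (mem_range_self (s, a)))⟩

theorem measurable_of_continuous [Countable A] [MeasurableSpace S] [DiscreteMeasurableSpace S]
    [MeasurableSpace A] [DiscreteMeasurableSpace A] {f : Stage S A → ℝ}
    (hf : ∀ s a, Continuous fun y => f (s, a, y)) : Measurable f :=
  measurable_from_prod_countable_right fun s =>
    measurable_from_prod_countable_right fun a => (hf s a).measurable

variable [Fintype A] [MeasurableSpace S] [MeasurableSpace A]

theorem integral_stageLaw [MeasurableSingletonClass S] [MeasurableSingletonClass A]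
    (q : stdSimplex ℝ S) (φ : S → stdSimplex ℝ A) {μ : ProbabilityMeasure (TransKernel S A)}
    {f : Stage S A → ℝ}
    (hf : ∀ s a, Integrable (fun y => f (s, a, y)) (μ : Measure (TransKernel S A))) :
    ∫ z, f z ∂stageLaw q φ μ =
      ∑ s, q s * ∑ a, φ s a * ∫ y, f (s, a, y) ∂(μ : Measure (TransKernel S A)) := by
  have hemb (s : S) (a : A) :
      MeasurableEmbedding fun y : TransKernel S A => ((s, a, y) : Stage S A) :=
    (measurableEmbedding_prodMk_left a).prodMk_left s
  have hdirac (s : S) (a : A) :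
      (Measure.dirac s).prod ((Measure.dirac a).prod (μ : Measure (TransKernel S A))) =
        (μ : Measure (TransKernel S A)).map fun y => (s, a, y) := by
    rw [Measure.dirac_prod, Measure.dirac_prod, Measure.map_map (by fun_prop) (by fun_prop)]
    rfl
  have hint (s : S) (a : A) : Integrable f (ENNReal.ofReal (q s * φ s a) •
      (Measure.dirac s).prod ((Measure.dirac a).prod (μ : Measure (TransKernel S A)))) := by
    rw [hdirac]
    exact ((hemb s a).integrable_map_iff.2 (hf s a)).smul_measure ENNReal.ofReal_ne_top
  rw [stageLaw, integral_finsetSum_measure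
    fun s _ => integrable_finsetSum_measure.2 fun a _ => hint s a]
  refine Finset.sum_congr rfl fun s _ => ?_
  rw [integral_finsetSum_measure fun a _ => hint s a, Finset.mul_sum]
  refine Finset.sum_congr rfl fun a _ => ?_
  rw [integral_smul_measure, hdirac, (hemb s a).integral_map, smul_eq_mul, ← mul_assoc,
    ENNReal.toReal_ofReal (mul_nonneg (stdSimplex.zero_le _ _) (stdSimplex.zero_le _ _))]

theorem integral_state_stageLaw [MeasurableSingletonClass S] [MeasurableSingletonClass A]
    (q : stdSimplex ℝ S) (φ : S → stdSimplex ℝ A) (μ : ProbabilityMeasure (TransKernel S A))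
    (w : S → ℝ) : ∫ z, w z.1 ∂stageLaw q φ μ = ∑ s, q s * w s := by
  rw [integral_stageLaw q φ fun s _ => integrable_const (w s)]
  simp only [integral_const, probReal_univ, one_smul, ← Finset.sum_mul, stdSimplex.sum_eq_one,
    one_mul]

end Stage

section Trajectory

variable {S A : Type*} [Fintype S] [Fintype A] [MeasurableSpace S] [DiscreteMeasurableSpace S]
  [MeasurableSpace A] [DiscreteMeasurableSpace A]
  (p₀ : stdSimplex ℝ S) (π : Policy S A) (μ : ProbabilityMeasure (TransKernel S A))
  {f : Stage S A → ℝ}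

theorem trajLaw_eq_comp : trajLaw p₀ π μ =
    (Kernel.traj (X := fun _ : ℕ => Stage S A) (stepKernel π μ) 0) ∘ₘ
    ((stageLaw p₀ (π 0 Fin.elim0) μ).map
      fun z => (fun _ => z : (i : Finset.Iic 0) → (fun _ : ℕ => Stage S A) i)) := rfl

instance : IsProbabilityMeasure (trajLaw p₀ π μ) := by
  have := isProbabilityMeasure_stageLaw p₀ (π 0 Fin.elim0) μ
  have := Measure.isProbabilityMeasure_map (μ := stageLaw p₀ (π 0 Fin.elim0) μ)
    (measurable_const_history (S := S) (A := A)).aemeasurable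
  rw [trajLaw_eq_comp]
  infer_instance

theorem trajLaw_map_zero :
    (trajLaw p₀ π μ).map (fun ω => ω 0) = stageLaw p₀ (π 0 Fin.elim0) μ := by
  have hf : (fun ω : ℕ → Stage S A => ω 0) =
      (fun h : (i : Finset.Iic 0) → (fun _ : ℕ => Stage S A) i => h ⟨0, by simp⟩) ∘
        Preorder.frestrictLe 0 := rfl
  rw [hf, ← Measure.map_map (by fun_prop) (by fun_prop), trajLaw_eq_comp,
    Measure.map_comp _ _ (by fun_prop), Kernel.traj_map_frestrictLe, Kernel.partialTraj_self,
    Measure.id_comp, Measure.map_map (by fun_prop) measurable_const_history]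
  exact Measure.map_id

theorem trajLaw_map_succ (n : ℕ) :
    (trajLaw p₀ π μ).map (fun ω => ω (n + 1)) =
      (stepKernel π μ n) ∘ₘ ((trajLaw p₀ π μ).map (Preorder.frestrictLe n)) := by
  rw [trajLaw_eq_comp, Measure.map_comp _ _ (by fun_prop), Measure.map_comp _ _ (by fun_prop),
    Kernel.traj_map_frestrictLe, Measure.comp_assoc,
    ← Kernel.traj_comp_partialTraj (Nat.zero_le n), Kernel.map_comp, Kernel.map_traj_succ_self]

theorem integrable_trajLaw (hf : ∀ s a, Continuous fun y => f (s, a, y)) (n : ℕ) :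
    Integrable (fun ω => f (ω n)) (trajLaw p₀ π μ) := by
  obtain ⟨M, hM⟩ := exists_forall_abs_le_of_continuous hf
  exact Integrable.of_bound
    ((measurable_of_continuous hf).comp (measurable_pi_apply n)).aestronglyMeasurable M
    (.of_forall fun ω => hM (ω n))

theorem integral_trajLaw_zero (hf : ∀ s a, Continuous fun y => f (s, a, y)) :
    ∫ ω, f (ω 0) ∂trajLaw p₀ π μ = ∫ z, f z ∂stageLaw p₀ (π 0 Fin.elim0) μ := by
  rw [← trajLaw_map_zero p₀ π μ, integral_map (measurable_pi_apply 0).aemeasurable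
    (measurable_of_continuous hf).aestronglyMeasurable]

theorem integral_trajLaw_succ (hf : ∀ s a, Continuous fun y => f (s, a, y)) (n : ℕ) :
    ∫ ω, f (ω (n + 1)) ∂trajLaw p₀ π μ =
      ∫ ω, ∫ z, f z ∂stepKernel π μ n (Preorder.frestrictLe n ω) ∂trajLaw p₀ π μ := by
  have hfm : Measurable f := measurable_of_continuous hf
  have heval : Measurable fun ω : ℕ → Stage S A => ω (n + 1) := measurable_pi_apply _
  have hint : Integrable f ((trajLaw p₀ π μ).map fun ω => ω (n + 1)) :=
    (integrable_map_measure hfm.aestronglyMeasurable heval.aemeasurable).2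
      (integrable_trajLaw p₀ π μ hf (n + 1))
  rw [trajLaw_map_succ, Measure.comp_eq_comp_const_apply] at hint
  rw [← integral_map heval.aemeasurable hfm.aestronglyMeasurable, trajLaw_map_succ,
    Measure.comp_eq_comp_const_apply, Kernel.integral_comp hint, Kernel.const_apply,
    integral_map (by fun_prop)]
  exact hfm.stronglyMeasurable.integral_kernel.aestronglyMeasurable

theorem integral_trajLaw_nonneg (hf : ∀ s a, Continuous fun y => f (s, a, y))
    (h : ∀ q t past, 0 ≤ ∫ z, f z ∂stageLaw q (π t past) μ) :
    ∀ n, 0 ≤ ∫ ω, f (ω n) ∂trajLaw p₀ π μ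
  | 0 => by
    rw [integral_trajLaw_zero p₀ π μ hf]
    exact h _ _ _
  | n + 1 => by
    rw [integral_trajLaw_succ p₀ π μ hf]
    exact integral_nonneg fun ω => h _ _ _

theorem hasSum_integral_discounted {γ : ℝ} (hγ0 : 0 ≤ γ) (hγ1 : γ < 1)
    (hf : ∀ s a, Continuous fun y => f (s, a, y)) :
    HasSum (fun n => γ ^ n * ∫ ω, f (ω n) ∂trajLaw p₀ π μ)
      (∫ ω, ∑' n, γ ^ n * f (ω n) ∂trajLaw p₀ π μ) := by
  obtain ⟨M, hM⟩ := exists_forall_abs_le_of_continuous hf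
  have hbound (n : ℕ) (ω : ℕ → Stage S A) : ‖γ ^ n * f (ω n)‖ ≤ γ ^ n * M := by
    rw [norm_mul, norm_pow, Real.norm_of_nonneg hγ0]
    exact mul_le_mul_of_nonneg_left (hM _) (pow_nonneg hγ0 n)
  have hint (n : ℕ) : Integrable (fun ω => γ ^ n * f (ω n)) (trajLaw p₀ π μ) :=
    (integrable_trajLaw p₀ π μ hf n).const_mul _
  have hsummable : Summable fun n => ∫ ω, ‖γ ^ n * f (ω n)‖ ∂trajLaw p₀ π μ := by
    refine ((summable_geometric_of_lt_one hγ0 hγ1).mul_right M).of_nonneg_of_le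
      (fun n => integral_nonneg fun ω => norm_nonneg _) fun n => ?_
    simpa only [integral_const, probReal_univ, one_smul] using
      integral_mono (hint n).norm (integrable_const _) (hbound n)
  simpa only [integral_const_mul] using hasSum_integral_of_summable_integral_norm hint hsummable

theorem bddAbove_image_discountedCost {γ : ℝ} (hγ0 : 0 ≤ γ) (hγ1 : γ < 1) (c : S → A → ℝ)
    (D : Set (ProbabilityMeasure (TransKernel S A))) :
    BddAbove (discountedCost c γ p₀ π '' D) := by
  let cost (z : Stage S A) : ℝ := c z.1 z.2.1
  have hcont (s : S) (a : A) : Continuous fun y => cost (s, a, y) := continuous_const (y := c s a)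
  obtain ⟨M, hM⟩ := exists_forall_abs_le_of_continuous hcont
  refine ⟨(1 - γ)⁻¹ * M, forall_mem_image.2 fun μ _ => ?_⟩
  refine hasSum_le (fun n => mul_le_mul_of_nonneg_left ?_ (pow_nonneg hγ0 n))
    (hasSum_integral_discounted p₀ π μ hγ0 hγ1 hcont)
    ((hasSum_geometric_of_lt_one hγ0 hγ1).mul_right M)
  simpa only [integral_const, probReal_univ, one_smul] using
    integral_mono (integrable_trajLaw p₀ π μ hcont n) (integrable_const M)
      fun ω => (le_abs_self _).trans (hM (ω n))

end Trajectory

section Verification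

variable {S A : Type*} [Fintype S]

/-- The law of the row of the state `s` under the law `μ` of a full transition kernel. -/
noncomputable def marginal (μ : ProbabilityMeasure (TransKernel S A)) (s : S) :
    ProbabilityMeasure (StateKernel S A) :=
  μ.map (measurable_pi_apply s).aemeasurable

theorem marginal_pi (m : S → ProbabilityMeasure (StateKernel S A)) (s : S) :
    marginal (ProbabilityMeasure.pi m) s = m s := by
  refine ProbabilityMeasure.toMeasure_injective ?_
  rw [marginal, ProbabilityMeasure.toMeasure_map, ProbabilityMeasure.toMeasure_pi]
  exact (measurePreserving_eval _ s).map_eq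

/-- The conditional expectation of `w (s_{t+1})` given the stage `(s_t, a_t, y_t)`. -/
def nextValue (w : S → ℝ) (z : Stage S A) : ℝ := ∑ s', z.2.2 z.1 z.2.1 s' * w s'

/-- The error `c_{sa} + γ y_{sa}ᵀ w - w_s` of the value vector `w` in the Bellman equation, at one
stage `(s, a, y)`. -/
def bellmanResidual (c : S → A → ℝ) (γ : ℝ) (w : S → ℝ) (z : Stage S A) : ℝ :=
  c z.1 z.2.1 + γ * nextValue w z - w z.1

theorem continuous_nextValue (w : S → ℝ) (s : S) (a : A) :
    Continuous fun y : TransKernel S A => nextValue w (s, a, y) := by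
  simpa only [zero_add, one_mul] using!
    (continuous_cost_add_sum 0 1 w a).comp (continuous_apply (A := fun _ => StateKernel S A) s)

theorem continuous_bellmanResidual (c : S → A → ℝ) (γ : ℝ) (w : S → ℝ) (s : S) (a : A) :
    Continuous fun y => bellmanResidual c γ w (s, a, y) :=
  (((continuous_nextValue w s a).const_mul γ).const_add (c s a)).sub
    (continuous_const (y := w s))

variable [Fintype A] [MeasurableSpace S] [MeasurableSpace A]

theorem integral_bellmanResidual_stageLaw [MeasurableSingletonClass S] [MeasurableSingletonClass A]
    (c : S → A → ℝ) (γ : ℝ) (w : S → ℝ) (q : stdSimplex ℝ S) (φ : S → stdSimplex ℝ A)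
    (μ : ProbabilityMeasure (TransKernel S A)) :
    ∫ z, bellmanResidual c γ w z ∂stageLaw q φ μ =
      ∑ s, q s * (bellmanCost (c s) γ w (φ s) (marginal μ s) - w s) := by
  have hcont := continuous_bellmanResidual c γ w
  have hrow (s : S) (a : A) :
      ∫ y, bellmanResidual c γ w (s, a, y) ∂(μ : Measure (TransKernel S A)) =
        actionValue (c s) γ w (marginal μ s) a - w s := by
    have hcost := continuous_cost_add_sum (c s a) γ w a
    rw [actionValue, marginal, ProbabilityMeasure.toMeasure_map,
      integral_map (measurable_pi_apply s).aemeasurable hcost.aestronglyMeasurable]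
    have hint : Integrable (fun y : TransKernel S A => c s a + γ * nextValue w (s, a, y))
        (μ : Measure (TransKernel S A)) := integrable_of_continuous
      (continuous_const.add (continuous_const.mul (continuous_nextValue w s a))) _
    simpa only [integral_const, probReal_univ, one_smul] using!
      integral_sub hint (integrable_const (w s))
  rw [integral_stageLaw q φ fun s a => integrable_of_continuous (hcont s a) _]
  simp only [hrow, bellmanCost_eq_sum, mul_sub, Finset.sum_sub_distrib, ← Finset.sum_mul,
    stdSimplex.sum_eq_one, one_mul]

variable [DiscreteMeasurableSpace S] [DiscreteMeasurableSpace A]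
  {c : S → A → ℝ} {γ : ℝ} {w : S → ℝ} {p₀ : stdSimplex ℝ S} {π : Policy S A}
  {μ : ProbabilityMeasure (TransKernel S A)}

theorem integral_state_trajLaw_succ (w : S → ℝ) (n : ℕ) :
    ∫ ω, w (ω (n + 1)).1 ∂trajLaw p₀ π μ = ∫ ω, nextValue w (ω n) ∂trajLaw p₀ π μ := by
  rw [integral_trajLaw_succ (f := fun z => w z.1) p₀ π μ fun s _ => continuous_const (y := w s)]
  exact integral_congr_ae (.of_forall fun ω => integral_state_stageLaw _ _ μ w)

theorem integral_bellmanResidual_trajLaw (c : S → A → ℝ) (γ : ℝ) (w : S → ℝ) (n : ℕ) :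
    ∫ ω, bellmanResidual c γ w (ω n) ∂trajLaw p₀ π μ =
      ∫ ω, c (ω n).1 (ω n).2.1 ∂trajLaw p₀ π μ + γ * ∫ ω, w (ω (n + 1)).1 ∂trajLaw p₀ π μ -
        ∫ ω, w (ω n).1 ∂trajLaw p₀ π μ := by
  have hcost : Integrable (fun ω => c (ω n).1 (ω n).2.1) (trajLaw p₀ π μ) :=
    integrable_trajLaw (f := fun z => c z.1 z.2.1) p₀ π μ
      (fun s a => continuous_const (y := c s a)) n
  have hvalue : Integrable (fun ω => w (ω n).1) (trajLaw p₀ π μ) :=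
    integrable_trajLaw (f := fun z => w z.1) p₀ π μ (fun s _ => continuous_const (y := w s)) n
  have hnext : Integrable (fun ω => γ * nextValue w (ω n)) (trajLaw p₀ π μ) :=
    (integrable_trajLaw p₀ π μ (continuous_nextValue w) n).const_mul γ
  have hsum : Integrable (fun ω => c (ω n).1 (ω n).2.1 + γ * nextValue w (ω n))
      (trajLaw p₀ π μ) := hcost.add hnext
  simp only [bellmanResidual]
  rw [integral_sub hsum hvalue, integral_add hcost hnext, integral_const_mul,
    integral_state_trajLaw_succ]

theorem hasSum_bellmanResidual (hγ0 : 0 ≤ γ) (hγ1 : γ < 1) (c : S → A → ℝ) (w : S → ℝ) :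
    HasSum (fun n => γ ^ n * ∫ ω, bellmanResidual c γ w (ω n) ∂trajLaw p₀ π μ)
      (discountedCost c γ p₀ π μ - ∑ s, p₀ s * w s) := by
  have hcost := hasSum_integral_discounted (f := fun z => c z.1 z.2.1) p₀ π μ hγ0 hγ1
    fun s a => continuous_const (y := c s a)
  have hvalue := hasSum_integral_discounted (f := fun z => w z.1) p₀ π μ hγ0 hγ1
    fun s _ => continuous_const (y := w s)
  have hinit : ∫ ω, w (ω 0).1 ∂trajLaw p₀ π μ = ∑ s, p₀ s * w s := by
    rw [integral_trajLaw_zero (f := fun z => w z.1) p₀ π μ fun s _ => continuous_const (y := w s),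
      integral_state_stageLaw]
  have hshift := (hasSum_nat_add_iff' 1).2 hvalue
  simp only [Finset.sum_range_one, pow_zero, one_mul, hinit] at hshift
  convert! (hcost.add hshift).sub hvalue using 1
  · funext n
    rw [integral_bellmanResidual_trajLaw]
    ring
  · rw [discountedCost]
    ring

theorem le_discountedCost (hγ0 : 0 ≤ γ) (hγ1 : γ < 1)
    (h : ∀ t past s, w s ≤ bellmanCost (c s) γ w (π t past s) (marginal μ s)) :
    ∑ s, p₀ s * w s ≤ discountedCost c γ p₀ π μ := by
  refine sub_nonneg.1 ((hasSum_bellmanResidual hγ0 hγ1 c w).nonneg fun n =>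
    mul_nonneg (pow_nonneg hγ0 n) ?_)
  refine integral_trajLaw_nonneg p₀ π μ (continuous_bellmanResidual c γ w) (fun q t past => ?_) n
  rw [integral_bellmanResidual_stageLaw]
  exact Finset.sum_nonneg fun s _ =>
    mul_nonneg (stdSimplex.zero_le _ _) (sub_nonneg.2 (h t past s))

theorem discountedCost_le (hγ0 : 0 ≤ γ) (hγ1 : γ < 1)
    (h : ∀ t past s, bellmanCost (c s) γ w (π t past s) (marginal μ s) ≤ w s) :
    discountedCost c γ p₀ π μ ≤ ∑ s, p₀ s * w s := by
  refine sub_nonpos.1 ((hasSum_bellmanResidual hγ0 hγ1 c w).nonpos fun n =>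
    mul_nonpos_of_nonneg_of_nonpos (pow_nonneg hγ0 n) (neg_nonneg.1 ?_))
  rw [← integral_neg]
  refine integral_trajLaw_nonneg (f := fun z => -bellmanResidual c γ w z) p₀ π μ
    (fun s a => (continuous_bellmanResidual c γ w s a).neg) (fun q t past => ?_) n
  rw [integral_neg, integral_bellmanResidual_stageLaw, neg_nonneg]
  exact Finset.sum_nonpos fun s _ =>
    mul_nonpos_of_nonneg_of_nonpos (stdSimplex.zero_le _ _) (sub_nonpos.2 (h t past s))

end Verification

section Optimality

variable {S A : Type*} [Fintype S] [Fintype A] {c : S → A → ℝ} {γ : ℝ}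
  {Ds : S → Set (ProbabilityMeasure (StateKernel S A))} {w : S → ℝ}

theorem exists_forall_isMinOn
    (hw : ∀ s, IsLeast (bellmanObjective (c s) γ (Ds s) w '' stdSimplex ℝ A) (w s)) :
    ∃ x : S → stdSimplex ℝ A, ∀ s,
      IsMinOn (bellmanObjective (c s) γ (Ds s) w) (stdSimplex ℝ A) (x s) := by
  choose x hx hxw using fun s => (hw s).1
  exact ⟨fun s => ⟨x s, hx s⟩, fun s y hy =>
    (hxw s).trans_le ((hw s).2 (mem_image_of_mem _ hy))⟩

variable [MeasurableSpace S] [DiscreteMeasurableSpace S] [MeasurableSpace A]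
  [DiscreteMeasurableSpace A]

theorem exists_mem_rectangular_forall_le_discountedCost (hγ0 : 0 ≤ γ) (hγ1 : γ < 1)
    (hD : ∀ s, IsCompact (Ds s)) (hDne : ∀ s, (Ds s).Nonempty)
    (hDconv : ∀ s, Convex ℝ≥0∞ ((↑) '' Ds s : Set (Measure (StateKernel S A))))
    (hw : ∀ s, ∀ x ∈ stdSimplex ℝ A, w s ≤ bellmanObjective (c s) γ (Ds s) w x) :
    ∃ μ ∈ rectangular Ds, ∀ p₀ π, ∑ s, p₀ s * w s ≤ discountedCost c γ p₀ π μ := by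
  choose m hm hle using fun s =>
    exists_mem_forall_le_actionValue (hD s) (hDne s) (hDconv s) (hw s)
  refine ⟨ProbabilityMeasure.pi m, ⟨m, hm, rfl⟩, fun p₀ π =>
    le_discountedCost hγ0 hγ1 fun t past s => ?_⟩
  rw [marginal_pi, bellmanCost_eq_sum]
  calc w s = ∑ a, π t past s a * w s := by
        rw [← Finset.sum_mul, stdSimplex.sum_eq_one, one_mul]
    _ ≤ ∑ a, π t past s a * actionValue (c s) γ w (m s) a := by
        gcongr with a
        · exact stdSimplex.zero_le _ _
        · exact hle s a

theorem discountedCost_stationary_le (hγ0 : 0 ≤ γ) (hγ1 : γ < 1) (hD : ∀ s, IsCompact (Ds s))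
    {x : S → stdSimplex ℝ A} (hx : ∀ s, bellmanObjective (c s) γ (Ds s) w (x s) ≤ w s)
    (p₀ : stdSimplex ℝ S) {μ : ProbabilityMeasure (TransKernel S A)} (hμ : μ ∈ rectangular Ds) :
    discountedCost c γ p₀ (stationary x) μ ≤ ∑ s, p₀ s * w s := by
  obtain ⟨m, hm, rfl⟩ := hμ
  refine discountedCost_le hγ0 hγ1 fun _ _ s => ?_
  rw [marginal_pi]
  exact ((isGreatest_bellmanObjective (hD s) ⟨_, hm s⟩ (x s)).2
    (mem_image_of_mem _ (hm s))).trans (hx s)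

theorem isGreatest_discountedCost_of_isMinOn (hγ0 : 0 ≤ γ) (hγ1 : γ < 1)
    (hD : ∀ s, IsCompact (Ds s)) (hDne : ∀ s, (Ds s).Nonempty)
    (hDconv : ∀ s, Convex ℝ≥0∞ ((↑) '' Ds s : Set (Measure (StateKernel S A))))
    (hw : ∀ s, IsLeast (bellmanObjective (c s) γ (Ds s) w '' stdSimplex ℝ A) (w s))
    {x : S → stdSimplex ℝ A}
    (hx : ∀ s, IsMinOn (bellmanObjective (c s) γ (Ds s) w) (stdSimplex ℝ A) (x s))
    (p₀ : stdSimplex ℝ S) :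
    IsGreatest (discountedCost c γ p₀ (stationary x) '' rectangular Ds) (∑ s, p₀ s * w s) := by
  have hxw (s : S) : bellmanObjective (c s) γ (Ds s) w (x s) ≤ w s := by
    obtain ⟨y, hy, hyw⟩ := (hw s).1
    exact (hx s hy).trans_eq hyw
  have hle (μ : ProbabilityMeasure (TransKernel S A)) (hμ : μ ∈ rectangular Ds) :=
    discountedCost_stationary_le hγ0 hγ1 hD hxw p₀ hμ
  obtain ⟨μ, hμ, hge⟩ := exists_mem_rectangular_forall_le_discountedCost hγ0 hγ1 hD hDne hDconv
    fun s _ hy => (hw s).2 (mem_image_of_mem _ hy)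
  exact ⟨⟨μ, hμ, (hle μ hμ).antisymm (hge _ _)⟩, forall_mem_image.2 hle⟩

theorem le_worstCaseCost (hγ0 : 0 ≤ γ) (hγ1 : γ < 1) (hD : ∀ s, IsCompact (Ds s))
    (hDne : ∀ s, (Ds s).Nonempty)
    (hDconv : ∀ s, Convex ℝ≥0∞ ((↑) '' Ds s : Set (Measure (StateKernel S A))))
    (hw : ∀ s, ∀ x ∈ stdSimplex ℝ A, w s ≤ bellmanObjective (c s) γ (Ds s) w x)
    (p₀ : stdSimplex ℝ S) (π : Policy S A) :
    ∑ s, p₀ s * w s ≤ worstCaseCost c γ (rectangular Ds) p₀ π := by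
  obtain ⟨μ, hμ, hge⟩ :=
    exists_mem_rectangular_forall_le_discountedCost hγ0 hγ1 hD hDne hDconv hw
  exact (hge p₀ π).trans (le_csSup (bddAbove_image_discountedCost p₀ π hγ0 hγ1 c _)
    (mem_image_of_mem _ hμ))

theorem valueVector_rectangular_eq [DecidableEq S] (hγ0 : 0 ≤ γ) (hγ1 : γ < 1)
    (hD : ∀ s, IsCompact (Ds s)) (hDne : ∀ s, (Ds s).Nonempty)
    (hDconv : ∀ s, Convex ℝ≥0∞ ((↑) '' Ds s : Set (Measure (StateKernel S A))))
    (hw : ∀ s, IsLeast (bellmanObjective (c s) γ (Ds s) w '' stdSimplex ℝ A) (w s)) :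
    valueVector c γ (rectangular Ds) = w := by
  ext s
  have hvertex : ∑ s', stdSimplex.vertex (S := ℝ) s s' * w s' = w s := by
    simp [Pi.single_apply]
  have hge (x : S → stdSimplex ℝ A) :
      w s ≤ worstCaseCost c γ (rectangular Ds) (stdSimplex.vertex s) (stationary x) :=
    hvertex.symm.trans_le (le_worstCaseCost hγ0 hγ1 hD hDne hDconv
      (fun s _ hy => (hw s).2 (mem_image_of_mem _ hy)) _ _)
  obtain ⟨x, hx⟩ := exists_forall_isMinOn hw
  have hle : worstCaseCost c γ (rectangular Ds) (stdSimplex.vertex s) (stationary x) = w s :=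
    (isGreatest_discountedCost_of_isMinOn hγ0 hγ1 hD hDne hDconv hw hx _).csSup_eq.trans hvertex
  exact IsLeast.csInf_eq ⟨⟨x, hle⟩, forall_mem_range.2 hge⟩

end Optimality

end DRMDP

theorem mainTheorem5_general {S A : Type*} [Fintype S] [DecidableEq S] [MeasurableSpace S]
    [DiscreteMeasurableSpace S] [Fintype A] [Nonempty A] [MeasurableSpace A]
    [DiscreteMeasurableSpace A]
    (c : S → A → ℝ) (γ : ℝ) (hγ0 : 0 ≤ γ) (hγ1 : γ < 1)
    (Ds : S → Set (ProbabilityMeasure (DRMDP.StateKernel S A)))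
    (hDs : ∀ s, IsCompact (Ds s)) (hDne : ∀ s, (Ds s).Nonempty)
    (hDconv : ∀ s, Convex ℝ≥0∞ ((↑) '' Ds s : Set (Measure (DRMDP.StateKernel S A))))
    (D : Set (ProbabilityMeasure (DRMDP.TransKernel S A))) (hD : D = DRMDP.rectangular Ds)
    (v : S → ℝ) (hv : v = DRMDP.valueVector c γ D)
    (g : S → (A → ℝ) → ℝ) (hg : g = fun s => DRMDP.bellmanObjective (c s) γ (Ds s) v) :
    (∀ s, (∀ x, IsGreatest (DRMDP.bellmanCost (c s) γ v x '' Ds s) (g s x)) ∧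
      ConvexOn ℝ Set.univ (g s) ∧ LowerSemicontinuous (g s)) ∧
    (∀ s, IsLeast (g s '' stdSimplex ℝ A) (v s)) ∧
    (∃ x : S → stdSimplex ℝ A, ∀ s, IsMinOn (g s) (stdSimplex ℝ A) (x s)) ∧
    (∀ x : S → stdSimplex ℝ A, (∀ s, IsMinOn (g s) (stdSimplex ℝ A) (x s)) →
      ∀ p₀ : stdSimplex ℝ S,
        IsGreatest (DRMDP.discountedCost c γ p₀ (DRMDP.stationary x) '' D)
          (DRMDP.worstCaseCost c γ D p₀ (DRMDP.stationary x)) ∧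
        ∀ π : DRMDP.Policy S A,
          DRMDP.worstCaseCost c γ D p₀ (DRMDP.stationary x) ≤ DRMDP.worstCaseCost c γ D p₀ π) := by
  obtain ⟨w, hw⟩ := DRMDP.exists_bellman_fixedPoint hγ0 hγ1 c hDs hDne
  obtain rfl : v = w := by
    rw [hv, hD, DRMDP.valueVector_rectangular_eq hγ0 hγ1 hDs hDne hDconv hw]
  subst hD hg
  refine ⟨fun s => ⟨DRMDP.isGreatest_bellmanObjective (hDs s) (hDne s),
    DRMDP.convexOn_bellmanObjective (hDs s) (hDne s),
    (DRMDP.continuous_bellmanObjective (hDs s) (hDne s)).lowerSemicontinuous⟩,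
    hw, DRMDP.exists_forall_isMinOn hw, fun x hx p₀ => ?_⟩
  have hgreatest :=
    DRMDP.isGreatest_discountedCost_of_isMinOn hγ0 hγ1 hDs hDne hDconv hw hx p₀
  have hcost : DRMDP.worstCaseCost c γ (DRMDP.rectangular Ds) p₀ (DRMDP.stationary x) =
      ∑ s, p₀ s * v s := hgreatest.csSup_eq
  rw [hcost]
  exact ⟨hgreatest, DRMDP.le_worstCaseCost hγ0 hγ1 hDs hDne hDconv
    (fun s _ hy => (hw s).2 (Set.mem_image_of_mem _ hy)) p₀⟩

theorem mainTheorem5 {S A : Type*} [Fintype S] [DecidableEq S] [MeasurableSpace S]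
    [DiscreteMeasurableSpace S] [Fintype A] [Nonempty A] [MeasurableSpace A]
    [DiscreteMeasurableSpace A]
    (c : S → A → ℝ) (γ : ℝ) (hγ0 : 0 ≤ γ) (hγ1 : γ < 1)
    (d : DRMDP.StateKernel S A → DRMDP.StateKernel S A → ℝ) (hd : DRMDP.IsKernelMetric d)
    {N : ℕ} (hN : 0 < N) (yhat : S → Fin N → DRMDP.StateKernel S A) (θ : ℝ) (hθ : 0 ≤ θ)
    (Ds : S → Set (ProbabilityMeasure (DRMDP.StateKernel S A)))
    (hDs : Ds = fun s => DRMDP.stateAmbiguity d (yhat s) θ)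
    (D : Set (ProbabilityMeasure (DRMDP.TransKernel S A))) (hD : D = DRMDP.rectangular Ds)
    (v : S → ℝ) (hv : v = DRMDP.valueVector c γ D)
    (g : S → (A → ℝ) → ℝ) (hg : g = fun s => DRMDP.bellmanObjective (c s) γ (Ds s) v) :
    -- the Bellman objectives are attained maxima and closed (proper, real-valued) convex functions
    (∀ s, (∀ x, IsGreatest (DRMDP.bellmanCost (c s) γ v x '' Ds s) (g s x)) ∧
      ConvexOn ℝ Set.univ (g s) ∧ LowerSemicontinuous (g s)) ∧
    -- the Bellman equation, with an attained minimum over the simplex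
    (∀ s, IsLeast (g s '' stdSimplex ℝ A) (v s)) ∧
    -- there is a stationary Markovian policy made of minimizers in the Bellman equation
    (∃ x : S → stdSimplex ℝ A, ∀ s, IsMinOn (g s) (stdSimplex ℝ A) (x s)) ∧
    -- and each such policy is optimal, for every initial distribution, among all policies
    (∀ x : S → stdSimplex ℝ A, (∀ s, IsMinOn (g s) (stdSimplex ℝ A) (x s)) →
      ∀ p₀ : stdSimplex ℝ S,
        IsGreatest (DRMDP.discountedCost c γ p₀ (DRMDP.stationary x) '' D)
          (DRMDP.worstCaseCost c γ D p₀ (DRMDP.stationary x)) ∧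
        ∀ π : DRMDP.Policy S A,
          DRMDP.worstCaseCost c γ D p₀ (DRMDP.stationary x) ≤ DRMDP.worstCaseCost c γ D p₀ π) := by
  subst hDs
  exact mainTheorem5_general c γ hγ0 hγ1 _
    (fun s => DRMDP.isCompact_stateAmbiguity hd.continuous hN (yhat s))
    (fun s => DRMDP.nonempty_stateAmbiguity hd.continuous.measurable
      (fun y => (hd.eq_zero_iff y y).2 rfl) hN (yhat s))
    (fun s => DRMDP.convex_image_stateAmbiguity (yhat s)) D hD v hv g hg
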